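/- For a finite group $G$ let $k(G)$ denote the number of conjugacy classes of $G$, and for a prime $p$ let $k_p(G) = k(P)$, where $P$ is any Sylow $p$-subgroup of $G$ (all Sylow $p$-subgroups of $G$ are conjugate, so this does not depend on $P$). Let $n$ be a positive integer, and let $S_n$ and $A_n$ be the symmetric and the alternating group on $n$ letters. Then $$k(S_n) \le \prod_{p \mid n!} k_p(S_n) \qquad\text{and}\qquad k(A_n) \le \prod_{p \mid |A_n|} k_p(A_n),$$ where the products run over the primes $p$ dividing $|S_n| = n!$ and over the primes $p$ dividing $|A_n|$, respectively; here $|A_n| = n!/2$ for $n \ge 2$, and $|A_1| = 1$. An empty product equals $1$. -/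

import Mathlib

/-- The class number `k(G)`: the number of conjugacy classes of `G`. It is used for finite groups
only. -/
noncomputable def classNumber (G : Type*) [Group G] : ℕ :=
  Nat.card (ConjClasses G)

open Equiv

/-! Since `k(G)|G|` counts commuting pairs, it is monotone under embeddings. A Sylow `p`-subgroup
`P` contains an elementary abelian group `A` of rank `q = n / p` (disjoint `p`-cycles, even when `p`
is odd), so `|A|^2 ≤ k(P)|P|`, and Legendre's formula for `|P|` gives `k(P) ≥ p^(q - q/(p-1))`.

In the other direction, `k(S_n)` is at most the number of partitions of `n`, hence at most a
Fibonacci number, and `k(A_n) ≤ 2 k(S_n)`. The primes 3, 5, 7 already beat Fibonacci growth for `n ≥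
5` (`fib_le_sylowBound`); the prime 2 supplies the remaining constant. -/

theorem classNumber_mul_card (G : Type*) [Group G] :
    classNumber G * Nat.card G = Nat.card {x : G × G // Commute x.1 x.2} :=
  (card_comm_eq_card_conjClasses_mul_card G).symm

theorem classNumber_pos (G : Type*) [Group G] [Finite G] : 1 ≤ classNumber G :=
  Nat.one_le_iff_ne_zero.2 Nat.card_pos.ne'

theorem classNumber_le_card (G : Type*) [Group G] [Finite G] : classNumber G ≤ Nat.card G :=
  Nat.card_le_card_of_surjective _ ConjClasses.mk_surjective

theorem two_le_classNumber (G : Type*) [Group G] [Finite G] [Nontrivial G] :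
    2 ≤ classNumber G := by
  obtain ⟨g, hg⟩ := exists_ne (1 : G)
  have : Nontrivial (ConjClasses G) :=
    ⟨ConjClasses.mk g, ConjClasses.mk 1, fun h => hg (by
      rwa [ConjClasses.mk_eq_mk_iff_isConj, isConj_comm, isConj_one_right] at h)⟩
  exact Finite.one_lt_card

/-- A finite group has at least as many commuting pairs as any group that embeds into it. -/
theorem classNumber_mul_card_le_of_injective {G H : Type*} [Group G] [Group H] [Finite G]
    (f : H →* G) (hf : Function.Injective f) :
    classNumber H * Nat.card H ≤ classNumber G * Nat.card G := by
  rw [classNumber_mul_card, classNumber_mul_card]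
  refine Nat.card_le_card_of_injective
    (fun x => ⟨(f x.1.1, f x.1.2), x.2.map f⟩) fun x y h => ?_
  simp only [Subtype.mk.injEq, Prod.mk.injEq] at h
  exact Subtype.ext (Prod.ext (hf h.1) (hf h.2))

theorem classNumber_eq_card_of_comm {G : Type*} [Group G] (h : ∀ a b : G, a * b = b * a) :
    classNumber G = Nat.card G := by
  refine (Nat.card_eq_of_bijective ConjClasses.mk ⟨fun a b hab => ?_,
    ConjClasses.mk_surjective⟩).symm
  obtain ⟨c, hc⟩ := isConj_iff.1 (ConjClasses.mk_eq_mk_iff_isConj.1 hab)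
  rw [← hc, h c a, mul_inv_cancel_right]

theorem card_sq_le_classNumber_sylow {G A : Type*} [Group G] [Finite G] [CommGroup A] {p : ℕ}
    [Fact p.Prime] (hA : IsPGroup p A) (f : A →* G) (hf : Function.Injective f)
    (P : Sylow p G) : Nat.card A ^ 2 ≤ classNumber P * Nat.card P := by
  obtain ⟨Q, hQ⟩ := (hA.of_surjective f.rangeRestrict f.rangeRestrict_surjective).exists_le_sylow
  let g : A →* Q := f.codRestrict Q.toSubgroup fun a => hQ ⟨a, rfl⟩
  have hg : Function.Injective ((Sylow.equiv Q P : Q →* P).comp g) :=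
    (Sylow.equiv Q P).injective.comp fun a b h => hf (congrArg Subtype.val h)
  have := classNumber_mul_card_le_of_injective _ hg
  rwa [classNumber_eq_card_of_comm mul_comm, ← sq] at this

/-- With `q = n / p`, `v_p(n!) = q + v_p(q!)`, and `(p - 1) v_p(q!)` is `q` minus its base-`p` digit
sum. -/
theorem factorization_factorial_le (p n : ℕ) [hp : Fact p.Prime] :
    (n.factorial).factorization p ≤ n / p + n / p / (p - 1) := by
  rw [Nat.factorization_def _ hp.out, ← padicValNat_mul_div_factorial, padicValNat_factorial_mul,
    add_comm]
  have h1 := hp.out.two_le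
  gcongr
  rw [Nat.le_div_iff_mul_le (by omega), mul_comm, sub_one_mul_padicValNat_factorial]
  exact Nat.sub_le _ _

/-- A lower bound for the class number of a Sylow `p`-subgroup of a group whose order divides `n!`
and that contains an elementary abelian subgroup of rank `n / p`. -/
theorem pow_le_classNumber_sylow {G : Type*} [Group G] [Finite G] {p n : ℕ} [hp : Fact p.Prime]
    (hG : Nat.card G ∣ n.factorial) (f : (Fin (n / p) → Multiplicative (ZMod p)) →* G)
    (hf : Function.Injective f) (P : Sylow p G) :
    p ^ (n / p - n / p / (p - 1)) ≤ classNumber P := by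
  have hcard : Nat.card (Fin (n / p) → Multiplicative (ZMod p)) = p ^ (n / p) := by
    simp
  have h := card_sq_le_classNumber_sylow (IsPGroup.of_card hcard) f hf P
  have hP : Nat.card P ≤ p ^ (n / p + n / p / (p - 1)) := by
    rw [P.card_eq_multiplicity]
    refine Nat.pow_le_pow_right hp.out.pos (le_trans ?_ (factorization_factorial_le p n))
    exact (Nat.factorization_le_iff_dvd Nat.card_pos.ne' n.factorial_ne_zero).2 hG p
  have hq : n / p / (p - 1) ≤ n / p := Nat.div_le_self _ _
  refine Nat.le_of_mul_le_mul_right (?_ : _ * p ^ (n / p + n / p / (p - 1)) ≤ _)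
    (pow_pos hp.out.pos _)
  calc p ^ (n / p - n / p / (p - 1)) * p ^ (n / p + n / p / (p - 1))
      = Nat.card (Fin (n / p) → Multiplicative (ZMod p)) ^ 2 := by
        rw [hcard, ← pow_add, ← pow_mul]; congr 1; omega
    _ ≤ _ := h
    _ ≤ _ := Nat.mul_le_mul_left _ hP

theorem exists_injective_zmod_pi_perm (p n : ℕ) [NeZero p] :
    ∃ f : (Fin (n / p) → Multiplicative (ZMod p)) →* Perm (Fin n), Function.Injective f := by
  have hle : Nonempty ((Σ _ : Fin (n / p), Multiplicative (ZMod p)) ↪ Fin n) := by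
    refine Function.Embedding.nonempty_of_card_le ?_
    simpa [ZMod.card] using Nat.div_mul_le_self n p
  obtain ⟨ι⟩ := hle
  let t := MulAction.toPermHom (Multiplicative (ZMod p)) (Multiplicative (ZMod p))
  have ht : Function.Injective t := MulAction.toPerm_injective
  let g : (Fin (n / p) → Multiplicative (ZMod p)) →*
      (Fin (n / p) → Perm (Multiplicative (ZMod p))) := t.compLeft _
  have hg : Function.Injective g := fun a b h => funext fun i => ht (congrFun h i)
  exact ⟨(Perm.viaEmbeddingHom ι).comp ((Perm.sigmaCongrRightHom _).comp g),
    (Perm.viaEmbeddingHom_injective ι).comp (Perm.sigmaCongrRightHom_injective.comp hg)⟩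

theorem exists_injective_zmod_pi_alternatingGroup (p n : ℕ) [NeZero p] (hp : Odd p) :
    ∃ f : (Fin (n / p) → Multiplicative (ZMod p)) →* alternatingGroup (Fin n),
      Function.Injective f := by
  obtain ⟨f, hf⟩ := exists_injective_zmod_pi_perm p n
  refine ⟨f.codRestrict (alternatingGroup (Fin n)) fun a => ?_,
    fun a b h => hf (congrArg Subtype.val h)⟩
  have ha : a ^ p = 1 := funext fun i =>
    Multiplicative.toAdd.injective (by simp)
  have : Perm.sign (f a) ^ p = 1 := by rw [← map_pow, ← map_pow, ha, map_one, map_one]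
  rw [Perm.mem_alternatingGroup]
  rcases Int.units_eq_one_or (Perm.sign (f a)) with h | h
  · exact h
  · rw [h, hp.neg_one_pow] at this
    exact absurd this (by decide)

theorem pow_le_classNumber_sylow_perm {p n : ℕ} [hp : Fact p.Prime]
    (P : Sylow p (Perm (Fin n))) : p ^ (n / p - n / p / (p - 1)) ≤ classNumber P := by
  obtain ⟨f, hf⟩ := exists_injective_zmod_pi_perm p n
  exact pow_le_classNumber_sylow (by rw [Nat.card_perm, Nat.card_fin]) f hf P

theorem pow_le_classNumber_sylow_alternatingGroup {p n : ℕ} [hp : Fact p.Prime] (hodd : Odd p)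
    (P : Sylow p (alternatingGroup (Fin n))) :
    p ^ (n / p - n / p / (p - 1)) ≤ classNumber P := by
  obtain ⟨f, hf⟩ := exists_injective_zmod_pi_alternatingGroup p n hodd
  refine pow_le_classNumber_sylow ?_ f hf P
  have := (alternatingGroup (Fin n)).card_subgroup_dvd_card
  rwa [Nat.card_perm, Nat.card_fin] at this

/-- Delete a part 1 if there is one; otherwise trade a chosen part `m ≥ 2` for `m - 2` ones. -/
theorem card_partition_add_two_le (n : ℕ) :
    Nat.card (Nat.Partition (n + 2)) ≤
      Nat.card (Nat.Partition (n + 1)) + Nat.card (Nat.Partition n) := by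
  classical
  have hex (s : Nat.Partition (n + 2)) : ∃ m, m ∈ s.parts :=
    Multiset.exists_mem_of_ne_zero fun h => by simpa [h] using s.parts_sum
  choose m hm using hex
  have hsum (s : Nat.Partition (n + 2)) (a : ℕ) (ha : a ∈ s.parts) :
      a + (s.parts.erase a).sum = n + 2 := by
    rw [← Multiset.sum_cons, Multiset.cons_erase ha, s.parts_sum]
  have htwo (s : Nat.Partition (n + 2)) (h : 1 ∉ s.parts) : 2 ≤ m s := by
    have := s.parts_pos (hm s)
    have : m s ≠ 1 := fun e => h (e ▸ hm s)
    omega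
  let F (s : Nat.Partition (n + 2)) : Nat.Partition (n + 1) ⊕ Nat.Partition n :=
    if h : 1 ∈ s.parts then
      .inl ⟨s.parts.erase 1, fun hi => s.parts_pos (Multiset.mem_of_mem_erase hi), by
        have := hsum s 1 h; omega⟩
    else
      .inr ⟨s.parts.erase (m s) + Multiset.replicate (m s - 2) 1, fun {i} hi => by
        rcases Multiset.mem_add.1 hi with hi | hi
        · exact s.parts_pos (Multiset.mem_of_mem_erase hi)
        · rw [Multiset.eq_of_mem_replicate hi]; exact one_pos, by
        have := hsum s (m s) (hm s)
        have := htwo s h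
        simp; omega⟩
  have hF : Function.Injective F := by
    intro s t hst
    by_cases hs : 1 ∈ s.parts <;> by_cases ht : 1 ∈ t.parts <;>
      simp only [F, hs, ht, dite_true, dite_false, Sum.inl.injEq, Sum.inr.injEq, reduceCtorEq,
        Nat.Partition.mk.injEq] at hst
    · ext1
      rw [← Multiset.cons_erase hs, hst, Multiset.cons_erase ht]
    -- All ones in the image are new, so their number recovers the traded part.
    · have hc := congrArg (Multiset.count 1) hst
      have hs0 : Multiset.count 1 (s.parts.erase (m s)) = 0 :=
        Multiset.count_eq_zero.2 fun h => hs (Multiset.mem_of_mem_erase h)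
      have ht0 : Multiset.count 1 (t.parts.erase (m t)) = 0 :=
        Multiset.count_eq_zero.2 fun h => ht (Multiset.mem_of_mem_erase h)
      rw [Multiset.count_add, Multiset.count_add, hs0, ht0, Multiset.count_replicate_self,
        Multiset.count_replicate_self] at hc
      have h1 := htwo s hs
      have h2 := htwo t ht
      have hmm : m s = m t := by omega
      rw [hmm, add_left_inj] at hst
      ext1
      rw [← Multiset.cons_erase (hm t), ← hst, ← hmm, Multiset.cons_erase (hm s)]
  simpa [Nat.card_sum] using Nat.card_le_card_of_injective F hF

theorem card_partition_le_fib (n : ℕ) : Nat.card (Nat.Partition n) ≤ Nat.fib (n + 1) := by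
  induction n using Nat.twoStepInduction with
  | zero => simp
  | one => simp
  | more n h0 h1 =>
    have := card_partition_add_two_le n
    rw [Nat.fib_add_two (n := n + 1)]
    omega

theorem classNumber_perm_le_fib (n : ℕ) : classNumber (Perm (Fin n)) ≤ Nat.fib (n + 1) := by
  have h : Nat.card (ConjClasses (Perm (Fin n))) ≤
      Nat.card (Nat.Partition (Fintype.card (Fin n))) := by
    refine Nat.card_le_card_of_injective
      (Quotient.lift Perm.partition fun _ _ h => Perm.partition_eq_of_isConj.1 h) ?_
    rintro ⟨a⟩ ⟨b⟩ h
    exact ConjClasses.mk_eq_mk_iff_isConj.2 (Perm.partition_eq_of_isConj.2 h)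
  rw [Fintype.card_fin] at h
  exact h.trans (card_partition_le_fib n)

theorem classNumber_alternatingGroup_le {n : ℕ} (hn : 2 ≤ n) :
    classNumber (alternatingGroup (Fin n)) ≤ 2 * classNumber (Perm (Fin n)) := by
  have : Nontrivial (Fin n) := Fin.nontrivial_iff_two_le.2 hn
  have h := classNumber_mul_card_le_of_injective (alternatingGroup (Fin n)).subtype
    Subtype.val_injective
  rw [← two_mul_nat_card_alternatingGroup (α := Fin n), ← mul_assoc, mul_comm _ 2] at h
  exact Nat.le_of_mul_le_mul_right h Nat.card_pos

/-- A lower bound for the product of the class numbers of the Sylow `p`-subgroups of the symmetric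
group of degree `n`, for `p = 3, 5, 7`. -/
def sylowBound (n : ℕ) : ℕ :=
  3 ^ (n / 3 - n / 3 / 2) * 5 ^ (n / 5 - n / 5 / 4) * 7 ^ (n / 7 - n / 7 / 6)

theorem sylowBound_add_thirty (n : ℕ) : Nat.fib 32 * sylowBound n ≤ sylowBound (n + 30) := by
  calc Nat.fib 32 * sylowBound n ≤ (3 ^ 5 * 5 ^ 4 * 7 ^ 3) * sylowBound n :=
        -- Shifting `n` by 30 raises the exponents of 3, 5, 7 by at least 5, 4, 3.
        Nat.mul_le_mul_right _ (by norm_num)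
    _ = 3 ^ (n / 3 - n / 3 / 2 + 5) * 5 ^ (n / 5 - n / 5 / 4 + 4) *
          7 ^ (n / 7 - n / 7 / 6 + 3) := by rw [sylowBound]; ring
    _ ≤ sylowBound (n + 30) := by
      unfold sylowBound
      gcongr <;> omega

theorem fib_add_thirty_le (n : ℕ) : Nat.fib (n + 30 + 1) ≤ Nat.fib 32 * Nat.fib (n + 1) := by
  have h := Nat.fib_add n 30
  have h1 : Nat.fib n ≤ Nat.fib (n + 1) := Nat.fib_le_fib_succ
  have h2 : Nat.fib 32 = Nat.fib 30 + Nat.fib 31 := Nat.fib_add_two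
  rw [h, h2]
  nlinarith

theorem fib_le_sylowBound {n : ℕ} (hn : 5 ≤ n) : Nat.fib (n + 1) ≤ sylowBound n := by
  induction n using Nat.strong_induction_on with
  | _ n ih =>
    rcases lt_or_ge n 35 with h | h
    · interval_cases n <;> norm_num [sylowBound]
    · obtain ⟨m, rfl⟩ := Nat.exists_eq_add_of_le' (show 30 ≤ n by omega)
      exact (fib_add_thirty_le m).trans ((Nat.mul_le_mul_left _ (ih m (by omega) (by omega))).trans
        (sylowBound_add_thirty m))

theorem fib_le_two_mul_sylowBound (n : ℕ) : Nat.fib (n + 1) ≤ 2 * sylowBound n := by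
  rcases lt_or_ge n 5 with h | h
  · interval_cases n <;> norm_num [sylowBound, Nat.fib_add_two]
  · have := fib_le_sylowBound h
    omega

/-- Primes not dividing `|G|` have trivial Sylow subgroups and contribute 1, so `{2, 3, 5, 7}` can
be used for every `n`. -/
theorem prod_le_prod_classNumber_sylow {G : Type*} [Group G] [Finite G]
    (P : (p : ℕ) → Sylow p G) (s : Finset ℕ) (hs : ∀ p ∈ s, p.Prime) :
    ∏ p ∈ s, classNumber (P p) ≤ ∏ p ∈ (Nat.card G).primeFactors, classNumber (P p) := by
  rw [← Finset.prod_filter_mul_prod_filter_not s (fun p => p ∣ Nat.card G),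
    Finset.prod_eq_one (s := s.filter fun p => ¬ p ∣ Nat.card G), mul_one]
  · refine Finset.prod_le_prod_of_subset_of_one_le' (fun p hp => ?_) fun p _ _ => classNumber_pos _
    rw [Finset.mem_filter] at hp
    exact Nat.mem_primeFactors.2 ⟨hs p hp.1, hp.2, Nat.card_pos.ne'⟩
  · intro p hp
    rw [Finset.mem_filter] at hp
    have : Fact p.Prime := ⟨hs p hp.1⟩
    refine le_antisymm ((classNumber_le_card _).trans ?_) (classNumber_pos _)
    rw [(P p).card_eq_multiplicity, Nat.factorization_eq_zero_of_not_dvd hp.2, pow_zero]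

theorem two_le_classNumber_sylow {G : Type*} [Group G] [Finite G] {p : ℕ} [Fact p.Prime]
    (hG : p ∣ Nat.card G) (P : Sylow p G) : 2 ≤ classNumber P := by
  have := P.toSubgroup.nontrivial_iff_ne_bot.2 (P.ne_bot_of_dvd_card hG)
  exact two_le_classNumber P

theorem mul_sylowBound_le_prod {G : Type*} [Group G] [Finite G] {n c : ℕ}
    (P : (p : ℕ) → Sylow p G) (h2 : c ≤ classNumber (P 2))
    (h : ∀ p, p.Prime → Odd p → p ^ (n / p - n / p / (p - 1)) ≤ classNumber (P p)) :
    c * sylowBound n ≤ ∏ p ∈ (Nat.card G).primeFactors, classNumber (P p) := by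
  refine le_trans ?_ (prod_le_prod_classNumber_sylow P {2, 3, 5, 7} (by simp; norm_num))
  rw [Finset.prod_insert (by simp), Finset.prod_insert (by simp), Finset.prod_insert (by simp),
    Finset.prod_singleton, sylowBound, mul_assoc (3 ^ _)]
  gcongr
  exacts [h 3 (by norm_num) (by decide), h 5 (by norm_num) (by decide),
    h 7 (by norm_num) (by decide)]

theorem four_le_classNumber_sylow_two_alternatingGroup_four
    (P : Sylow 2 (alternatingGroup (Fin 4))) : 4 ≤ classNumber P := by
  have hc : Nat.card (alternatingGroup (Fin 4)) = 2 ^ 2 * 3 := by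
    have h := two_mul_nat_card_alternatingGroup (α := Fin 4)
    rw [Nat.card_perm, Nat.card_fin] at h
    have : Nat.factorial 4 = 24 := rfl
    omega
  have hP : Nat.card P = 2 ^ 2 := by
    rw [P.card_eq_multiplicity, hc, Nat.factorization_mul (by norm_num) (by norm_num),
      Finsupp.add_apply, Nat.prime_two.factorization_pow, Nat.prime_three.factorization]
    simp
  have := IsPGroup.isMulCommutative_of_card_eq_prime_sq hP
  rw [classNumber_eq_card_of_comm this.is_comm.comm, hP]
  norm_num

theorem mainTheorem1 (n : ℕ) (hn : 1 ≤ n) :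
    (∀ P : (p : ℕ) → Sylow p (Equiv.Perm (Fin n)),
      classNumber (Equiv.Perm (Fin n)) ≤
        ∏ p ∈ (Nat.factorial n).primeFactors, classNumber (P p)) ∧
    (∀ Q : (p : ℕ) → Sylow p (alternatingGroup (Fin n)),
      classNumber (alternatingGroup (Fin n)) ≤
        ∏ p ∈ (Nat.card (alternatingGroup (Fin n))).primeFactors, classNumber (Q p)) := by
  rcases hn.eq_or_lt with rfl | hn
  · exact ⟨fun P => (classNumber_le_card _).trans
        (Finite.card_le_one_iff_subsingleton.2 inferInstance |>.trans
          (Finset.one_le_prod' fun p _ => classNumber_pos _)),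
      fun Q => (classNumber_le_card _).trans
        (Finite.card_le_one_iff_subsingleton.2 inferInstance |>.trans
          (Finset.one_le_prod' fun p _ => classNumber_pos _))⟩
  have : Nontrivial (Fin n) := Fin.nontrivial_iff_two_le.2 hn
  refine ⟨fun P => ?_, fun Q => ?_⟩
  · have hcard : Nat.card (Perm (Fin n)) = n.factorial := by rw [Nat.card_perm, Nat.card_fin]
    rw [← hcard]
    refine (classNumber_perm_le_fib n).trans ((fib_le_two_mul_sylowBound n).trans
      (mul_sylowBound_le_prod P (two_le_classNumber_sylow ?_ _) fun p hp _ => ?_))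
    · rw [hcard]
      exact (Nat.Prime.dvd_factorial Nat.prime_two).2 hn
    · have : Fact p.Prime := ⟨hp⟩
      exact pow_le_classNumber_sylow_perm (P p)
  · have hQ (p : ℕ) (hp : p.Prime) (hodd : Odd p) :
        p ^ (n / p - n / p / (p - 1)) ≤ classNumber (Q p) := by
      have : Fact p.Prime := ⟨hp⟩
      exact pow_le_classNumber_sylow_alternatingGroup hodd (Q p)
    have hcard := two_mul_nat_card_alternatingGroup (α := Fin n)
    rw [Nat.card_perm, Nat.card_fin] at hcard
    have hle := (classNumber_alternatingGroup_le hn).trans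
      (Nat.mul_le_mul_left 2 (classNumber_perm_le_fib n))
    rcases lt_or_ge n 4 with h | h
    · refine (classNumber_le_card _).trans
        (le_trans ?_ (mul_sylowBound_le_prod Q (classNumber_pos _) hQ))
      interval_cases n <;> simp [sylowBound, Nat.factorial] at hcard ⊢ <;> omega
    rcases h.eq_or_lt with rfl | h
    -- Here a factor 2 at the prime 2 fails (`2 * 5 > 2 * 3`); the abelian Sylow subgroup of order 4
    -- gives `10 ≤ 4 * 3`.
    · refine hle.trans (le_trans ?_ (mul_sylowBound_le_prod Q
        (four_le_classNumber_sylow_two_alternatingGroup_four (Q 2)) hQ))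
      norm_num [sylowBound]
    · refine hle.trans (le_trans (Nat.mul_le_mul_left 2 (fib_le_sylowBound h))
        (mul_sylowBound_le_prod Q (two_le_classNumber_sylow ?_ _) hQ))
      have h4 : 4 ∣ n.factorial := Nat.dvd_factorial (by norm_num) h.le
      omega
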